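/- Let $h:\mathbb R^2\to\mathbb R$ be $C^2$ with $h(x+1,x'+1)=h(x,x')$ and, for some constant $c>0$, $h_{12}\le -c$ everywhere (subscripts denote partial derivatives). For a tilt $F$ consider on sequences $\mathbf x=(x_n)_{n\in\mathbb Z}$ the tilted Frenkel--Kontorova gradient flow $\dot x_n=-h_2(x_{n-1},x_n)-h_1(x_n,x_{n+1})+F$; for a sequence $\mathbf z$, $\dot{\mathbf z}$ denotes the right-hand side evaluated at $\mathbf z$, and $\mathbf z$ is an equilibrium if $\dot{\mathbf z}=\mathbf 0$. Order sequences componentwise, $\mathbf x<\mathbf y$ meaning $\mathbf x\le\mathbf y$ and $\mathbf x\neq\mathbf y$; let $(T_{qp}\mathbf x)_n=x_{n-q}+p$ for $p,q\in\mathbb Z$; and say that $\mathbf x$ has mean spacing $\omega$ if $(x_n-x_0)/n\to\omega$ as $n\to\pm\infty$. Let $\mathcal X$ be the space of sequences with $\|\mathbf x\|=\sum_n2^{-|n|}|x_n|<\infty$. *Depinning force.* The width of $\mathbf x$ is $\sup_{m\in\mathbb Z}(n^+(m)-n^-(m))$, where $n^-(m)=\max\{n: T_{mn}\mathbf x\le\mathbf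 x\}$ and $n^+(m)=\min\{n:T_{mn}\mathbf x\ge\mathbf x\}$. Let $\mathcal X^1_\omega$ be the set of $\mathbf x\in\mathcal X$ with $(x_n-n\omega)_n$ bounded and width at most $1$. Let $\bar\nu(\omega,F)$ be the average velocity, i.e. the common limit of $\frac1{t(m-k)}\int_0^t\sum_{n=k}^{m-1}\dot x_n(s)\,ds$, as $m-k\to\infty$ and $t\to+\infty$, along forward orbits $\mathbf x(\cdot)$ of the flow in $\mathcal X^1_\omega$. Put $F_d(\omega)=\sup\{F\ge0:\bar\nu(\omega,F)=0\}$ and $F_d(p/q+)=\limsup_{\omega\searrow p/q}F_d(\omega)$. *IOCs.* An ordered circle is the image $\ell$ of a continuous map $\tau:\mathbb R\to\mathcal X$ with $\tau(s_1)<\tau(s_2)$ for $s_1<s_2$ and $\tau(s+1)=\tau(s)+\mathbf 1$. It is an invariant ordered circle (IOC) for the tilt $F$ if $T_{qp}\ell=\ell$ for all $q,p\in\mathbb Z$ and $\ell$ is invariant under the gradient flow with tilt $F$ for all times $t\in\mathbb R$. Let $p\in\mathbb Z$, $q\ge1$ be coprime. An IOC $\ell$ is of type $p/q+$ if every $\mathbf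 x\in\ell$ has mean spacing $p/q$ and satisfies $T_{qp}\mathbf x\le\mathbf x$, and some $\mathbf x\in\ell$ has $T_{qp}\mathbf x\ne\mathbf x$. An equilibrium $\mathbf x$ is of type $p/q+$ if it has mean spacing $p/q$ and $T_{qp}\mathbf x<\mathbf x$. **Theorem.** Let $F_d(p/q+)\le F<F_d(p/q)$, and let $\ell_F$ be an IOC of type $p/q+$ for the tilt $F$ such that $\dot{\mathbf z}\ge\mathbf 0$ for every $\mathbf z\in\ell_F$. Then every equilibrium $\mathbf x^*\in\ell_F$ of type $p/q+$ is degenerate: the formula $$(A\eta)_i=\alpha_i\eta_{i-1}+\beta_i\eta_i+\alpha_{i+1}\eta_{i+1},\qquad \alpha_i=-h_{12}(x^*_{i-1},x^*_i),\quad \beta_i=-h_{22}(x^*_{i-1},x^*_i)-h_{11}(x^*_i,x^*_{i+1}),$$ defines a bounded operator $A=-D^2W(\mathbf x^*)$ on the Hilbert space $\ell^2(\mathbb Z)$ (where $W(\mathbf x)=\sum_n [h(x_n,x_{n+1})-Fx_n]$ formally), and $0$ lies in the spectrum of $A$. -/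

import Mathlib

open Filter Topology

namespace FK

/-- A state of the chain. -/
abbrev State : Type := ℤ → ℝ

/-! ### Energy function and gradient vector field -/

/-- First partial derivative of `h` with respect to its first argument. -/
noncomputable def d1 (h : ℝ → ℝ → ℝ) (x x' : ℝ) : ℝ := deriv (fun y => h y x') x

/-- First partial derivative of `h` with respect to its second argument. -/
noncomputable def d2 (h : ℝ → ℝ → ℝ) (x x' : ℝ) : ℝ := deriv (fun y => h x y) x'

/-- Second partial derivatives. -/
noncomputable def d11 (h : ℝ → ℝ → ℝ) (x x' : ℝ) : ℝ := d1 (d1 h) x x'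

noncomputable def d12 (h : ℝ → ℝ → ℝ) (x x' : ℝ) : ℝ := d2 (d1 h) x x'

noncomputable def d22 (h : ℝ → ℝ → ℝ) (x x' : ℝ) : ℝ := d2 (d2 h) x x'

/-- Standing assumptions on the energy function: `C^2`, diagonally periodic, and
`h_12 ≤ -c < 0` for some constant `c`. -/
structure IsEnergy (h : ℝ → ℝ → ℝ) : Prop where
  contDiff : ContDiff ℝ 2 (fun z : ℝ × ℝ => h z.1 z.2)
  periodic : ∀ x x' : ℝ, h (x + 1) (x' + 1) = h x x'
  twist : ∃ c : ℝ, 0 < c ∧ ∀ x x' : ℝ, d12 h x x' ≤ -c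

/-- The gradient vector field of the chain with tilt `F`:
the `n`-th component is `-h_2(x_{n-1}, x_n) - h_1(x_n, x_{n+1}) + F`. -/
noncomputable def field (h : ℝ → ℝ → ℝ) (F : ℝ) (x : State) (n : ℤ) : ℝ :=
  -d2 h (x (n - 1)) (x n) - d1 h (x n) (x (n + 1)) + F

/-- Equilibria of the tilted chain. -/
def IsEquilibrium (h : ℝ → ℝ → ℝ) (F : ℝ) (x : State) : Prop :=
  ∀ n : ℤ, field h F x n = 0

/-- The translations `(T_{qp} x)_n = x_{n-q} + p`. -/
def T (q p : ℤ) (x : State) : State := fun n => x (n - q) + (p : ℝ)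

/-- `x` has mean spacing `ω`: `(x_n - x_0) / n → ω` as `n → ±∞`. -/
def HasMeanSpacing (x : State) (ω : ℝ) : Prop :=
  Tendsto (fun n : ℤ => (x n - x 0) / (n : ℝ)) atTop (𝓝 ω) ∧
    Tendsto (fun n : ℤ => (x n - x 0) / (n : ℝ)) atBot (𝓝 ω)

/-! ### Phase spaces -/

/-- The weight `2^{-|n|}`. -/
noncomputable def weight (n : ℤ) : ℝ := (2 : ℝ)⁻¹ ^ n.natAbs

/-- The space `𝒳` of states with `∑ 2^{-|n|} |x_n| < ∞`. -/
def X : Set State := {x | Summable fun n : ℤ => weight n * |x n|}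

/-- The norm of `𝒳`. -/
noncomputable def normX (x : State) : ℝ := ∑' n : ℤ, weight n * |x n|

/-- The states of width at most `k`: for every `m` the numbers
`n⁻(m) = max {n | T_{mn} x ≤ x}` and `n⁺(m) = min {n | T_{mn} x ≥ x}` exist and differ by at
most `k`. -/
def WidthLE (x : State) (k : ℤ) : Prop :=
  ∀ m : ℤ, ∃ nminus nplus : ℤ,
    IsGreatest {n : ℤ | T m n x ≤ x} nminus ∧ IsLeast {n : ℤ | x ≤ T m n x} nplus ∧
      nplus - nminus ≤ k

/-- `𝒳_ω^1`: the states in `𝒳` with `x_n - n ω` bounded and width at most one. -/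
def Xone (ω : ℝ) : Set State :=
  {x | x ∈ X ∧ (∃ B : ℝ, ∀ n : ℤ, |x n - (n : ℝ) * ω| ≤ B) ∧ WidthLE x 1}

/-! ### Average velocity and depinning force -/

/-- `x` is a forward orbit of the gradient flow in `𝒳_ω^1`. (On `𝒳_ω^1` all spacings
`x_{n+1} - x_n` lie in a fixed bounded interval, where the field is Lipschitz, so that the orbit
through a given initial state is unique.) -/
def IsForwardOrbit (h : ℝ → ℝ → ℝ) (F ω : ℝ) (x : ℝ → State) : Prop :=
  ∀ t : ℝ, 0 ≤ t → x t ∈ Xone ω ∧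
    ∀ n : ℤ, HasDerivWithinAt (fun s => x s n) (field h F (x t) n) (Set.Ici 0) t

/-- The orbit `x` has average velocity
`ν = lim (1 / (t (m - k))) ∫_0^t ∑_{n=k}^{m-1} ẋ_n(s) ds` as `m - k → ∞` and `t → ∞`.
The variable is `a = ((k, m), t)`. -/
def HasAverageVelocity (h : ℝ → ℝ → ℝ) (F : ℝ) (x : ℝ → State) (ν : ℝ) : Prop :=
  Tendsto
    (fun a : (ℤ × ℤ) × ℝ =>
      1 / (a.2 * ((a.1.2 : ℝ) - (a.1.1 : ℝ))) *
        ∫ s in (0 : ℝ)..a.2, ∑ n ∈ Finset.Ico a.1.1 a.1.2, field h F (x s) n)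
    (comap (fun a : (ℤ × ℤ) × ℝ => a.1.2 - a.1.1) atTop ⊓
      comap (fun a : (ℤ × ℤ) × ℝ => a.2) atTop)
    (𝓝 ν)

/-- `ν` is the average velocity for mean spacing `ω` and tilt `F`, i.e. the common
average velocity of the orbits in `𝒳_ω^1`. -/
def IsAverageVelocity (h : ℝ → ℝ → ℝ) (ω F ν : ℝ) : Prop :=
  ∀ x : ℝ → State, IsForwardOrbit h F ω x → HasAverageVelocity h F x ν

/-- The depinning force `F_d(ω) = sup {F ≥ 0 | average velocity at (ω, F) is 0}`. -/
noncomputable def depinningForce (h : ℝ → ℝ → ℝ) (ω : ℝ) : ℝ :=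
  sSup {F : ℝ | 0 ≤ F ∧ IsAverageVelocity h ω F 0}

/-- The value `F_d(ω₀+) = limsup_{ω ↘ ω₀} F_d(ω)`. -/
noncomputable def depinningForcePlus (h : ℝ → ℝ → ℝ) (ω₀ : ℝ) : ℝ :=
  limsup (fun ω : ℝ => depinningForce h ω) (𝓝[>] ω₀)

/-! ### Invariant ordered circles -/

/-- Ordered circles: images of maps `τ : ℝ → 𝒳`, continuous for the norm of `𝒳`, with
`τ s₁ < τ s₂` for `s₁ < s₂` and `τ (s + 1) = τ s + 𝟏`. -/
def IsOrderedCircle (ℓ : Set State) : Prop :=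
  ∃ τ : ℝ → State,
    (∀ s, τ s ∈ X) ∧
    (∀ s, Tendsto (fun r => normX (τ r - τ s)) (𝓝 s) (𝓝 0)) ∧
    (∀ s₁ s₂, s₁ < s₂ → τ s₁ < τ s₂) ∧
    (∀ s, τ (s + 1) = τ s + 1) ∧
    ℓ = Set.range τ

/-- Translation-invariant ordered circles. -/
def IsTOC (ℓ : Set State) : Prop :=
  IsOrderedCircle ℓ ∧ ∀ q p : ℤ, T q p '' ℓ = ℓ

/-- Invariance under the gradient flow for all `t ∈ ℝ`: through each state of `ℓ` there is an
orbit, defined for all times, that stays in `ℓ`. (The spacings of the states of a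
translation-invariant ordered circle lie in a fixed bounded interval, so such an orbit is the
orbit of the flow.) -/
def IsFlowInvariant (h : ℝ → ℝ → ℝ) (F : ℝ) (ℓ : Set State) : Prop :=
  ∀ x ∈ ℓ, ∃ u : ℝ → State, u 0 = x ∧
    (∀ (t : ℝ) (n : ℤ), HasDerivAt (fun s => u s n) (field h F (u t) n) t) ∧
    ∀ t : ℝ, u t ∈ ℓ

/-- Invariant ordered circles for tilt `F`. -/
def IsIOC (h : ℝ → ℝ → ℝ) (F : ℝ) (ℓ : Set State) : Prop :=
  IsTOC ℓ ∧ IsFlowInvariant h F ℓ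

/-- Invariant ordered circles of type `p/q+`. -/
def IsIOCPlus (h : ℝ → ℝ → ℝ) (F : ℝ) (p : ℤ) (q : ℕ) (ℓ : Set State) : Prop :=
  IsIOC h F ℓ ∧
    (∀ x ∈ ℓ, HasMeanSpacing x ((p : ℝ) / (q : ℝ)) ∧ T q p x ≤ x) ∧
    ∃ x ∈ ℓ, T q p x ≠ x

/-- Equilibria of type `p/q+`: mean spacing `p/q` and `T_{qp} x < x`, i.e. `T_{qp} x ≤ x` and
`T_{qp} x ≠ x`. -/
def IsEquilibriumPlus (h : ℝ → ℝ → ℝ) (F : ℝ) (p : ℤ) (q : ℕ) (x : State) : Prop :=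
  IsEquilibrium h F x ∧ HasMeanSpacing x ((p : ℝ) / (q : ℝ)) ∧ T q p x < x

/-! ### Degeneracy -/

/-- The real Hilbert space `ℓ²` of square-summable two-sided sequences. -/
abbrev Ell2 : Type := lp (fun _ : ℤ => ℝ) 2

/-- `A` is the Jacobi operator `-D²W(x)` on `ℓ²`:
`(A η)_i = α_i η_{i-1} + β_i η_i + α_{i+1} η_{i+1}` with `α_i = -h_12(x_{i-1}, x_i)` and
`β_i = -h_22(x_{i-1}, x_i) - h_11(x_i, x_{i+1})`. -/
def IsJacobiOperator (h : ℝ → ℝ → ℝ) (x : State) (A : Ell2 →L[ℝ] Ell2) : Prop :=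
  ∀ (η : Ell2) (i : ℤ),
    (A η) i = -d12 h (x (i - 1)) (x i) * η (i - 1)
      + (-d22 h (x (i - 1)) (x i) - d11 h (x i) (x (i + 1))) * η i
      + -d12 h (x i) (x (i + 1)) * η (i + 1)

/-- `x` is degenerate: `-D²W(x)` is a bounded operator on `ℓ²` and has `0` in its
spectrum. The formula determines the operator, so there is at most one such `A`. -/
def IsDegenerate (h : ℝ → ℝ → ℝ) (x : State) : Prop :=
  ∃ A : Ell2 →L[ℝ] Ell2, IsJacobiOperator h x A ∧ (0 : ℝ) ∈ spectrum ℝ A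

end FK

namespace FK

open scoped RealInnerProductSpace

/-! ### Calculus of the energy function -/

section Partial

variable {g : ℝ → ℝ → ℝ}

/-! The linearization of the field at an equilibrium `x` of the circle is the Jacobi operator `A`,
symmetric with off-diagonal entries at least `c > 0`. The circle supplies states `z` arbitrarily
close to `x` on both sides, and the sign of the field on it turns them into test sequences for `A`.

From below, strong comparison (`IsEnergy.lt_of_field_nonneg`) makes `x - z` strictly positive, and
it is a supersolution for coefficients close to those of `A`. As for a ground state, a Picone-type
identity then gives `A ≤ 0` as a form (`jacobi_form_nonpos_of_supersolution`,
`inner_jacobi_nonpos`). If `0` were not in the spectrum, symmetry would improve this to `⟪v, A v⟫ ≤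
-κ ‖v‖²` with `κ > 0` (`exists_coercive_of_nonpos`).

From above, `T q p x < x` places `T (-q) (-p) x` above `x` on the circle, at summable distance.
States between the two therefore differ from `x` by a nonzero element `w ≥ 0` of `ℓ²`, uniformly
small (`IsIOCPlus.exists_above`). This `w` is an approximate subsolution, so `⟪w, A w⟫ ≥ -3δ ‖w‖²`
(`le_inner_of_subsolution`), which contradicts coercivity once `3δ < κ`. -/

theorem d1_eq_fderiv {n : WithTop ℕ∞} (hg : ContDiff ℝ n (fun z : ℝ × ℝ => g z.1 z.2))
    (hn : n ≠ 0) (x y : ℝ) :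
    d1 g x y = fderiv ℝ (fun z : ℝ × ℝ => g z.1 z.2) (x, y) (1, 0) := by
  have h1 := (hg.differentiable hn (x, y)).hasFDerivAt
  have h2 : HasDerivAt (fun t : ℝ => (t, y)) ((1 : ℝ), (0 : ℝ)) x :=
    (hasDerivAt_id x).prodMk (hasDerivAt_const x y)
  exact (h1.comp_hasDerivAt x h2).deriv

theorem d2_eq_fderiv {n : WithTop ℕ∞} (hg : ContDiff ℝ n (fun z : ℝ × ℝ => g z.1 z.2))
    (hn : n ≠ 0) (x y : ℝ) :
    d2 g x y = fderiv ℝ (fun z : ℝ × ℝ => g z.1 z.2) (x, y) (0, 1) := by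
  have h1 := (hg.differentiable hn (x, y)).hasFDerivAt
  have h2 : HasDerivAt (fun t : ℝ => (x, t)) ((0 : ℝ), (1 : ℝ)) y :=
    (hasDerivAt_const y x).prodMk (hasDerivAt_id y)
  exact (h1.comp_hasDerivAt y h2).deriv

theorem contDiff_d1 {m n : WithTop ℕ∞} (hg : ContDiff ℝ n (fun z : ℝ × ℝ => g z.1 z.2))
    (hmn : m + 1 ≤ n) : ContDiff ℝ m (fun z : ℝ × ℝ => d1 g z.1 z.2) := by
  have hn : n ≠ 0 := by rintro rfl; simp at hmn
  simp only [d1_eq_fderiv hg hn]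
  exact (hg.fderiv_right hmn).clm_apply contDiff_const

theorem contDiff_d2 {m n : WithTop ℕ∞} (hg : ContDiff ℝ n (fun z : ℝ × ℝ => g z.1 z.2))
    (hmn : m + 1 ≤ n) : ContDiff ℝ m (fun z : ℝ × ℝ => d2 g z.1 z.2) := by
  have hn : n ≠ 0 := by rintro rfl; simp at hmn
  simp only [d2_eq_fderiv hg hn]
  exact (hg.fderiv_right hmn).clm_apply contDiff_const

/-- Mean value theorem for a `C^1` function of two variables, in terms of its partials. -/
theorem exists_sub_eq_partials (hg : ContDiff ℝ 1 (fun z : ℝ × ℝ => g z.1 z.2)) (P Q : ℝ × ℝ) :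
    ∃ ξ ∈ segment ℝ P Q, g Q.1 Q.2 - g P.1 P.2 =
      d1 g ξ.1 ξ.2 * (Q.1 - P.1) + d2 g ξ.1 ξ.2 * (Q.2 - P.2) := by
  have hd := hg.differentiable one_ne_zero
  obtain ⟨ξ, hξ, h⟩ := domain_mvt (s := Set.univ)
    (fun z _ => (hd z).hasFDerivAt.hasFDerivWithinAt) convex_univ (Set.mem_univ P)
    (Set.mem_univ Q)
  refine ⟨ξ, hξ, ?_⟩
  rw [d1_eq_fderiv hg one_ne_zero, d2_eq_fderiv hg one_ne_zero]
  have e : Q - P = (Q.1 - P.1) • ((1 : ℝ), (0 : ℝ)) + (Q.2 - P.2) • ((0 : ℝ), (1 : ℝ)) := by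
    ext <;> simp
  rw [h, e, map_add, map_smul, map_smul, smul_eq_mul, smul_eq_mul]
  simp only [mul_comm]

/-- Symmetry of second derivatives: both neighbours enter the linearized field through `h_12`, which
makes the Jacobi operator symmetric. -/
theorem d1_d2_eq_d12 (hg : ContDiff ℝ 2 (fun z : ℝ × ℝ => g z.1 z.2)) (x y : ℝ) :
    d1 (d2 g) x y = d12 g x y := by
  have h1 : ContDiff ℝ 1 (fun z : ℝ × ℝ => d1 g z.1 z.2) := contDiff_d1 hg (by norm_num)
  have h2 : ContDiff ℝ 1 (fun z : ℝ × ℝ => d2 g z.1 z.2) := contDiff_d2 hg (by norm_num)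
  rw [d12, d1_eq_fderiv h2 one_ne_zero, d2_eq_fderiv h1 one_ne_zero]
  have hs : IsSymmSndFDerivAt ℝ (fun z : ℝ × ℝ => g z.1 z.2) (x, y) :=
    hg.contDiffAt.isSymmSndFDerivAt (by simp)
  have hd : DifferentiableAt ℝ (fderiv ℝ (fun z : ℝ × ℝ => g z.1 z.2)) (x, y) :=
    (hg.fderiv_right (m := 1) (by norm_num)).differentiable one_ne_zero _
  simp only [d1_eq_fderiv hg two_ne_zero, d2_eq_fderiv hg two_ne_zero]
  have key : ∀ v : ℝ × ℝ, fderiv ℝ (fun z : ℝ × ℝ =>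
      fderiv ℝ (fun z : ℝ × ℝ => g z.1 z.2) (z.1, z.2) v) (x, y) =
      (fderiv ℝ (fderiv ℝ (fun z : ℝ × ℝ => g z.1 z.2)) (x, y)).flip v := by
    intro v
    rw [(hd.hasFDerivAt.clm_apply (hasFDerivAt_const v (x, y))).fderiv]
    simp
  rw [key, key]
  exact hs (1, 0) (0, 1)

theorem d1_add_one (hg : ∀ x x' : ℝ, g (x + 1) (x' + 1) = g x x') (x x' : ℝ) :
    d1 g (x + 1) (x' + 1) = d1 g x x' := by
  unfold d1
  rw [← deriv_comp_add_const (f := fun y => g y (x' + 1))]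
  simp only [hg]

theorem d2_add_one (hg : ∀ x x' : ℝ, g (x + 1) (x' + 1) = g x x') (x x' : ℝ) :
    d2 g (x + 1) (x' + 1) = d2 g x x' := by
  unfold d2
  rw [← deriv_comp_add_const (f := fun y => g (x + 1) y)]
  simp only [hg]

theorem diag_periodic_int (hg : ∀ x x' : ℝ, g (x + 1) (x' + 1) = g x x') (x x' : ℝ) (k : ℤ) :
    g (x + k) (x' + k) = g x x' := by
  induction k using Int.induction_on with
  | zero => simp
  | succ i ih => rw [← ih, ← hg (x + (i : ℤ))]; push_cast; simp only [add_assoc]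
  | pred i ih => rw [← ih, ← hg (x + ((-i - 1 : ℤ) : ℝ))]; push_cast; ring_nf

/-- A diagonal integer translation brings the first argument into `[0, 1]`, and the strip becomes
compact. -/
theorem bounded_on_strip (hc : Continuous (fun z : ℝ × ℝ => g z.1 z.2))
    (hg : ∀ x x' : ℝ, g (x + 1) (x' + 1) = g x x') (K : ℝ) :
    ∃ C : ℝ, ∀ x x' : ℝ, |x' - x| ≤ K → |g x x'| ≤ C := by
  obtain ⟨C, hC⟩ := (isCompact_Icc.prod isCompact_Icc : IsCompact
    (Set.Icc (0 : ℝ) 1 ×ˢ Set.Icc (-K) (K + 1))).exists_bound_of_continuousOn hc.continuousOn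
  refine ⟨C, fun x x' hx => ?_⟩
  have h := hC (x + ((-⌊x⌋ : ℤ) : ℝ), x' + ((-⌊x⌋ : ℤ) : ℝ)) (by
    have h1 := Int.floor_le x
    have h2 := Int.lt_floor_add_one x
    obtain ⟨h3, h4⟩ := abs_le.1 hx
    push_cast
    refine ⟨⟨?_, ?_⟩, ⟨?_, ?_⟩⟩ <;> simp only <;> linarith)
  simpa only [diag_periodic_int hg, Real.norm_eq_abs] using h

theorem uniformly_close_on_strip (hc : Continuous (fun z : ℝ × ℝ => g z.1 z.2))
    (hg : ∀ x x' : ℝ, g (x + 1) (x' + 1) = g x x') (K : ℝ) {δ : ℝ} (hδ : 0 < δ) :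
    ∃ r > 0, ∀ x x' y y' : ℝ, |x' - x| ≤ K → |y - x| ≤ r → |y' - x'| ≤ r →
      |g y y' - g x x'| ≤ δ := by
  -- This form of uniform continuity keeps only one of the two points in the compact set; the
  -- perturbed point may leave it.
  have h := (isCompact_Icc.prod isCompact_Icc : IsCompact
    (Set.Icc (0 : ℝ) 1 ×ˢ Set.Icc (-K) (K + 1))).uniformContinuousAt_of_continuousAt
    (fun z : ℝ × ℝ => g z.1 z.2) (fun _ _ => hc.continuousAt) (Metric.dist_mem_uniformity hδ)
  obtain ⟨r, hr, h⟩ := Metric.mem_uniformity_dist.1 h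
  refine ⟨r / 2, half_pos hr, fun x x' y y' hx h1 h2 => ?_⟩
  have h1' := abs_lt.1 (h1.trans_lt (half_lt_self hr))
  have h2' := abs_lt.1 (h2.trans_lt (half_lt_self hr))
  have := h (a := (x + ((-⌊x⌋ : ℤ) : ℝ), x' + ((-⌊x⌋ : ℤ) : ℝ)))
    (b := (y + ((-⌊x⌋ : ℤ) : ℝ), y' + ((-⌊x⌋ : ℤ) : ℝ))) (by
      rw [Prod.dist_eq, max_lt_iff]
      simp only [Real.dist_eq, abs_lt]
      refine ⟨⟨?_, ?_⟩, ⟨?_, ?_⟩⟩ <;> linarith) (by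
    have h1 := Int.floor_le x
    have h2 := Int.lt_floor_add_one x
    obtain ⟨h3, h4⟩ := abs_le.1 hx
    push_cast
    refine ⟨⟨?_, ?_⟩, ⟨?_, ?_⟩⟩ <;> simp only <;> linarith)
  simp only [diag_periodic_int hg] at this
  change dist _ _ < δ at this
  rw [Real.dist_eq, abs_sub_comm] at this
  exact this.le

end Partial

/-! ### Tridiagonal linearization of the vector field -/

theorem abs_sub_le_of_mem_segment {P Q ξ : ℝ × ℝ} (hξ : ξ ∈ segment ℝ P Q) {r : ℝ}
    (h1 : |Q.1 - P.1| ≤ r) (h2 : |Q.2 - P.2| ≤ r) : |ξ.1 - P.1| ≤ r ∧ |ξ.2 - P.2| ≤ r := by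
  rw [segment_eq_image'] at hξ
  obtain ⟨t, ⟨ht0, ht1⟩, rfl⟩ := hξ
  simp only [Prod.fst_add, Prod.snd_add, Prod.smul_fst, Prod.smul_snd, Prod.fst_sub,
    Prod.snd_sub, smul_eq_mul, add_sub_cancel_left, abs_mul, abs_of_nonneg ht0]
  constructor
  · exact (mul_le_of_le_one_left (abs_nonneg _) ht1).trans h1
  · exact (mul_le_of_le_one_left (abs_nonneg _) ht1).trans h2

/-- The coefficient `α_i = -h_12(x_{i-1}, x_i)`. -/
noncomputable def offDiag (h : ℝ → ℝ → ℝ) (x : State) (i : ℤ) : ℝ := -d12 h (x (i - 1)) (x i)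

/-- The coefficient `β_i = -h_22(x_{i-1}, x_i) - h_11(x_i, x_{i+1})`. -/
noncomputable def onDiag (h : ℝ → ℝ → ℝ) (x : State) (i : ℤ) : ℝ :=
  -d22 h (x (i - 1)) (x i) - d11 h (x i) (x (i + 1))

namespace IsEnergy

variable {h : ℝ → ℝ → ℝ}

theorem contDiff_d1 (hh : IsEnergy h) : ContDiff ℝ 1 (fun z : ℝ × ℝ => d1 h z.1 z.2) :=
  FK.contDiff_d1 hh.contDiff (by norm_num)

theorem contDiff_d2 (hh : IsEnergy h) : ContDiff ℝ 1 (fun z : ℝ × ℝ => d2 h z.1 z.2) :=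
  FK.contDiff_d2 hh.contDiff (by norm_num)

theorem continuous_d11 (hh : IsEnergy h) : Continuous (fun z : ℝ × ℝ => d11 h z.1 z.2) :=
  (FK.contDiff_d1 (m := 0) hh.contDiff_d1 (by norm_num)).continuous

theorem continuous_d12 (hh : IsEnergy h) : Continuous (fun z : ℝ × ℝ => d12 h z.1 z.2) :=
  (FK.contDiff_d2 (m := 0) hh.contDiff_d1 (by norm_num)).continuous

theorem continuous_d22 (hh : IsEnergy h) : Continuous (fun z : ℝ × ℝ => d22 h z.1 z.2) :=
  (FK.contDiff_d2 (m := 0) hh.contDiff_d2 (by norm_num)).continuous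

theorem d11_add_one (hh : IsEnergy h) (x x' : ℝ) : d11 h (x + 1) (x' + 1) = d11 h x x' :=
  d1_add_one (d1_add_one hh.periodic) x x'

theorem d12_add_one (hh : IsEnergy h) (x x' : ℝ) : d12 h (x + 1) (x' + 1) = d12 h x x' :=
  d2_add_one (d1_add_one hh.periodic) x x'

theorem d22_add_one (hh : IsEnergy h) (x x' : ℝ) : d22 h (x + 1) (x' + 1) = d22 h x x' :=
  d2_add_one (d2_add_one hh.periodic) x x'

/-- Differences of the vector field are given by tridiagonal coefficients, with off-diagonal
entries bounded below, and near a state of bounded spacing these are close to the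
coefficients of the linearization, uniformly in the site. -/
theorem field_sub_field (hh : IsEnergy h) (F : ℝ) {c : ℝ} (hc : ∀ y y' : ℝ, d12 h y y' ≤ -c)
    {x : State} {K : ℝ} (hK : ∀ n, |x (n + 1) - x n| ≤ K) {δ : ℝ} (hδ : 0 < δ) :
    ∃ r > 0, ∀ (z : State) (i : ℤ), ∃ a b a' : ℝ, c ≤ a ∧ c ≤ a' ∧
      field h F z i - field h F x i =
        a * (z (i - 1) - x (i - 1)) + b * (z i - x i) + a' * (z (i + 1) - x (i + 1)) ∧
      (|z (i - 1) - x (i - 1)| ≤ r → |z i - x i| ≤ r → |z (i + 1) - x (i + 1)| ≤ r →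
        |a - offDiag h x i| ≤ δ ∧ |b - onDiag h x i| ≤ δ ∧
          |a' - offDiag h x (i + 1)| ≤ δ) := by
  obtain ⟨r₁, hr₁, h₁⟩ := uniformly_close_on_strip hh.continuous_d11 hh.d11_add_one K
    (half_pos hδ)
  obtain ⟨r₂, hr₂, h₂⟩ := uniformly_close_on_strip hh.continuous_d12 hh.d12_add_one K hδ
  obtain ⟨r₃, hr₃, h₃⟩ := uniformly_close_on_strip hh.continuous_d22 hh.d22_add_one K
    (half_pos hδ)
  refine ⟨min r₁ (min r₂ r₃), lt_min hr₁ (lt_min hr₂ hr₃), fun z i => ?_⟩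
  obtain ⟨ξ, hξ, e⟩ := exists_sub_eq_partials hh.contDiff_d2 (x (i - 1), x i) (z (i - 1), z i)
  obtain ⟨ζ, hζ, e'⟩ := exists_sub_eq_partials hh.contDiff_d1 (x i, x (i + 1)) (z i, z (i + 1))
  rw [d1_d2_eq_d12 hh.contDiff] at e
  change _ = _ + d22 h ξ.1 ξ.2 * _ at e
  change _ = d11 h ζ.1 ζ.2 * _ + d12 h ζ.1 ζ.2 * _ at e'
  simp only at e e'
  refine ⟨-d12 h ξ.1 ξ.2, -d22 h ξ.1 ξ.2 - d11 h ζ.1 ζ.2, -d12 h ζ.1 ζ.2,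
    le_neg_of_le_neg (hc _ _), le_neg_of_le_neg (hc _ _), ?_, fun k₁ k₂ k₃ => ?_⟩
  · unfold field
    linear_combination -e - e'
  · obtain ⟨u₁, u₂⟩ := abs_sub_le_of_mem_segment hξ k₁ k₂
    obtain ⟨v₁, v₂⟩ := abs_sub_le_of_mem_segment hζ k₂ k₃
    simp only [le_min_iff] at u₁ u₂ v₁ v₂
    have s₁ : |x i - x (i - 1)| ≤ K := by simpa using hK (i - 1)
    have s₂ := hK i
    have A := abs_le.1 (h₂ _ _ _ _ s₁ u₁.2.1 u₂.2.1)
    have B := abs_le.1 (h₃ _ _ _ _ s₁ u₁.2.2 u₂.2.2)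
    have C := abs_le.1 (h₁ _ _ _ _ s₂ v₁.1 v₂.1)
    have D := abs_le.1 (h₂ _ _ _ _ s₂ v₁.2.1 v₂.2.1)
    unfold offDiag onDiag
    rw [add_sub_cancel_right]
    refine ⟨abs_le.2 ⟨?_, ?_⟩, abs_le.2 ⟨?_, ?_⟩, abs_le.2 ⟨?_, ?_⟩⟩ <;> linarith

end IsEnergy

/-! ### States of a translation-invariant ordered circle -/

theorem weight_pos (n : ℤ) : 0 < weight n := by unfold weight; positivity

theorem sub_mem_X {x y : State} (hx : x ∈ X) (hy : y ∈ X) : x - y ∈ X := by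
  refine Summable.of_nonneg_of_le (fun n => mul_nonneg (weight_pos n).le (abs_nonneg _))
    (fun n => ?_) (Summable.add hx hy)
  rw [← mul_add]
  exact mul_le_mul_of_nonneg_left (abs_sub _ _) (weight_pos n).le

theorem tendsto_apply_of_tendsto_normX {τ : ℝ → State} (hX : ∀ s, τ s ∈ X) {s : ℝ}
    (hc : Tendsto (fun r => normX (τ r - τ s)) (𝓝 s) (𝓝 0)) (n : ℤ) :
    Tendsto (fun r => τ r n) (𝓝 s) (𝓝 (τ s n)) := by
  rw [tendsto_iff_norm_sub_tendsto_zero]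
  have h := hc.const_mul (weight n)⁻¹
  rw [mul_zero] at h
  refine squeeze_zero (fun _ => norm_nonneg _) (fun r => ?_) h
  rw [le_inv_mul_iff₀ (weight_pos n)]
  exact (sub_mem_X (hX r) (hX s)).le_tsum n
    fun j _ => mul_nonneg (weight_pos j).le (abs_nonneg _)

theorem eventually_close_on_finset {τ : ℝ → State} (hX : ∀ s, τ s ∈ X) {s : ℝ}
    (hc : Tendsto (fun r => normX (τ r - τ s)) (𝓝 s) (𝓝 0)) (S : Finset ℤ) {r : ℝ}
    (hr : 0 < r) : ∀ᶠ t in 𝓝 s, ∀ n ∈ S, |τ t n - τ s n| ≤ r := by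
  rw [eventually_all_finset]
  intro n _
  have h := (tendsto_apply_of_tendsto_normX hX hc n).eventually (Metric.ball_mem_nhds _ hr)
  exact h.mono fun t ht => (Real.dist_eq _ _ ▸ Metric.mem_ball.1 ht).le

theorem map_add_int_of_map_add_one {τ : ℝ → State} (h1 : ∀ s, τ (s + 1) = τ s + 1) (s : ℝ)
    (k : ℤ) (n : ℤ) : τ (s + k) n = τ s n + k := by
  induction k using Int.induction_on with
  | zero => simp
  | succ i ih =>
    have := congrFun (h1 (s + (i : ℤ))) n
    rw [Pi.add_apply, Pi.one_apply, ih, add_assoc, add_assoc] at this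
    push_cast at this ⊢
    exact this
  | pred i ih =>
    have := congrFun (h1 (s + ((-i - 1 : ℤ) : ℝ))) n
    rw [Pi.add_apply, Pi.one_apply, add_assoc] at this
    push_cast at this ih ⊢
    rw [sub_add_cancel, ih] at this
    linarith

/-- A state of a translation-invariant ordered circle is compared with its shifts, up to
integers. -/
theorem IsTOC.exists_int_shift {ℓ : Set State} (hℓ : IsTOC ℓ) {x : State} (hx : x ∈ ℓ) (n : ℤ) :
    ∃ m : ℤ, ∀ j, x j + m ≤ x (j + n) ∧ x (j + n) ≤ x j + m + 1 := by
  obtain ⟨⟨τ, -, -, hm, h1, rfl⟩, hT⟩ := hℓ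
  obtain ⟨s, rfl⟩ := hx
  have hy : T (-n) 0 (τ s) ∈ Set.range τ := by
    rw [← hT (-n) 0]
    exact Set.mem_image_of_mem _ ⟨s, rfl⟩
  obtain ⟨t, ht⟩ := hy
  have hmono : StrictMono τ := fun a b => hm a b
  have hj : ∀ j, τ t j = τ s (j + n) := fun j => by simp [ht, T]
  -- The shifted state is `τ t`; it lies between the integer translates of `τ s` at the two integers
  -- around `t - s`.
  refine ⟨⌊t - s⌋, fun j => ?_⟩
  have f1 := Int.floor_le (t - s)
  have f2 := Int.lt_floor_add_one (t - s)
  have k1 := hmono.monotone (by linarith : s + (⌊t - s⌋ : ℤ) ≤ t) j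
  have k2 := hmono.monotone
    (by push_cast; linarith : t ≤ s + ((⌊t - s⌋ + 1 : ℤ) : ℝ)) j
  rw [map_add_int_of_map_add_one h1, hj] at k1 k2
  push_cast at k2
  exact ⟨k1, by linarith⟩

/-- Iterating the integer comparison along multiples of `n` forces `m ≤ n ω ≤ m + 1`. Since `x (j +
n) - x j` lies in the same unit interval, the two differ by at most one. -/
theorem IsTOC.abs_shift_sub_le {ℓ : Set State} (hℓ : IsTOC ℓ) {x : State} (hx : x ∈ ℓ) {ω : ℝ}
    (hω : HasMeanSpacing x ω) (n : ℕ) (j : ℤ) : |x (j + n) - x j - n * ω| ≤ 1 := by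
  rcases Nat.eq_zero_or_pos n with rfl | hn
  · simp
  obtain ⟨m, hm⟩ := hℓ.exists_int_shift hx n
  have hn' : (0 : ℝ) < n := by exact_mod_cast hn
  have iter : ∀ k : ℕ, (k : ℝ) * m ≤ x ((k : ℤ) * n) - x 0 ∧
      x ((k : ℤ) * n) - x 0 ≤ k * (m + 1) := by
    intro k
    induction k with
    | zero => simp
    | succ k ih =>
      have := hm ((k : ℤ) * n)
      rw [show ((k + 1 : ℕ) : ℤ) * n = k * n + n by push_cast; ring]
      push_cast
      constructor <;> linarith
  have lim : Tendsto (fun k : ℕ => (x ((k : ℤ) * n) - x 0) / (((k : ℤ) * n : ℤ) : ℝ)) atTop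
      (𝓝 ω) :=
    hω.1.comp (Tendsto.atTop_mul_const' (by exact_mod_cast hn) tendsto_natCast_atTop_atTop)
  have b1 : (m : ℝ) / n ≤ ω := by
    refine ge_of_tendsto lim ((eventually_gt_atTop 0).mono fun k hk => ?_)
    have hk' : (0 : ℝ) < k := by exact_mod_cast hk
    push_cast
    rw [div_le_div_iff₀ hn' (by positivity)]
    nlinarith [(iter k).1]
  have b2 : ω ≤ ((m : ℝ) + 1) / n := by
    refine le_of_tendsto lim ((eventually_gt_atTop 0).mono fun k hk => ?_)
    have hk' : (0 : ℝ) < k := by exact_mod_cast hk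
    push_cast
    rw [div_le_div_iff₀ (by positivity) hn']
    nlinarith [(iter k).2]
  rw [div_le_iff₀ hn'] at b1
  rw [le_div_iff₀ hn'] at b2
  obtain ⟨c1, c2⟩ := hm j
  rw [abs_le]
  constructor <;> linarith

/-! ### Summable and nearby perturbations inside the circle -/

/-- A shift by `q` is a sum of `q` unit steps. After exchanging the sums each inner sum telescopes
to at most `2B`, so the nonnegative terms have bounded partial sums. -/
theorem summable_shift_sub_nat {e : ℕ → ℝ} {B : ℝ} (hB : ∀ n, |e n| ≤ B) (q : ℕ)
    (h0 : ∀ n, 0 ≤ e (n + q) - e n) : Summable fun n => e (n + q) - e n := by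
  refine summable_of_sum_range_le (c := q * (B + B)) h0 fun N => ?_
  have : ∀ n, e (n + q) - e n = ∑ j ∈ Finset.range q, (e (n + 1 + j) - e (n + j)) := by
    intro n
    have := Finset.sum_range_sub (fun j => e (n + j)) q
    rw [add_zero] at this
    rw [← this]
    exact Finset.sum_congr rfl fun j _ => by ring_nf
  simp only [this]
  rw [Finset.sum_comm]
  calc _ ≤ ∑ j ∈ Finset.range q, (B + B) := Finset.sum_le_sum fun j _ => by
        have := Finset.sum_range_sub (fun n => e (n + j)) N
        rw [this]
        have h1 := abs_le.1 (hB (N + j))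
        have h2 := abs_le.1 (hB (0 + j))
        linarith
    _ = _ := by rw [Finset.sum_const, Finset.card_range, nsmul_eq_mul]

theorem summable_shift_sub {e : ℤ → ℝ} {B : ℝ} (hB : ∀ n, |e n| ≤ B) (q : ℕ)
    (h0 : ∀ n, 0 ≤ e (n + q) - e n) : Summable fun n => e (n + q) - e n := by
  refine Summable.of_nat_of_neg ?_ ?_
  · exact_mod_cast summable_shift_sub_nat (e := fun n : ℕ => e n) (fun n => hB n) q
      (fun n => by exact_mod_cast h0 n)
  -- The negative half-line is reflected; the extra minus sign keeps the increments nonnegative.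
  · have key : ∀ n : ℕ, -e (-((n + q : ℕ) : ℤ) + q) - -e (-(n : ℤ) + q) =
        e (-(n : ℤ) + q) - e (-(n : ℤ)) := fun n => by
      rw [show -((n + q : ℕ) : ℤ) + q = -(n : ℤ) by push_cast; ring]; ring
    have := summable_shift_sub_nat (e := fun n : ℕ => -e (-(n : ℤ) + q))
      (fun n => by simpa using hB _) q (fun n => by rw [key]; exact h0 _)
    simpa only [key] using this

theorem IsIOCPlus.abs_spacing_le {h : ℝ → ℝ → ℝ} {F : ℝ} {p : ℤ} {q : ℕ} {ℓ : Set State}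
    (hℓ : IsIOCPlus h F p q ℓ) {x : State} (hx : x ∈ ℓ) (n : ℤ) :
    |x (n + 1) - x n| ≤ 1 + |(p : ℝ) / q| := by
  have := hℓ.1.1.abs_shift_sub_le hx (hℓ.2.1 x hx).1 1 n
  push_cast at this
  rw [one_mul] at this
  linarith [abs_sub_abs_le_abs_sub (x (n + 1) - x n) ((p : ℝ) / q)]

/-- Subtracting the linear part `n ω` leaves a bounded sequence, and its increments over `q` sites
are exactly these differences because `q ω = p`. -/
theorem IsIOCPlus.summable_shift_sub {h : ℝ → ℝ → ℝ} {F : ℝ} {p : ℤ} {q : ℕ} (hq : 0 < q)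
    {ℓ : Set State} (hℓ : IsIOCPlus h F p q ℓ) {x : State} (hx : x ∈ ℓ) :
    Summable fun n => T (-q) (-p) x n - x n := by
  obtain ⟨hω, hT⟩ := hℓ.2.1 x hx
  have hq' : (q : ℝ) ≠ 0 := by positivity
  set ω : ℝ := (p : ℝ) / q with hωdef
  have hqω : q * ω = p := by rw [hωdef]; field_simp
  have hB : ∀ n : ℤ, |x n - n * ω| ≤ |x 0| + 1 := by
    intro n
    have key : |x n - n * ω - x 0| ≤ 1 := by
      obtain ⟨k, rfl | rfl⟩ := n.eq_nat_or_neg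
      · have := hℓ.1.1.abs_shift_sub_le hx hω k 0
        rw [zero_add] at this
        push_cast
        convert this using 2
        ring
      · have := hℓ.1.1.abs_shift_sub_le hx hω k (-k)
        rw [neg_add_cancel, abs_sub_comm] at this
        push_cast
        refine le_of_eq_of_le ?_ this
        rw [show x (-k) - -k * ω - x 0 = k * ω - (x 0 - x (-k)) by ring]
    linarith [abs_sub_abs_le_abs_sub (x n - n * ω) (x 0)]
  have key : ∀ n : ℤ, x (n + q) - ((n + q : ℤ) : ℝ) * ω - (x n - n * ω) =
      T (-q) (-p) x n - x n := fun n => by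
    simp only [T, sub_neg_eq_add]
    push_cast
    linear_combination -hqω
  have := FK.summable_shift_sub (e := fun n : ℤ => x n - n * ω) hB q fun n => by
    rw [key]
    have := hT (n + q)
    simp only [T, add_sub_cancel_right, sub_neg_eq_add] at this ⊢
    push_cast
    linarith
  simpa only [key] using this

/-- The state `T (-q) (-p) x` is some `τ t` above `x = τ s`, and summability leaves only finitely
many sites where they differ by more than `r`. Continuity controls those sites for a parameter just
above `s`; at all others monotonicity of `τ` suffices. The same sandwich dominates the squares. -/
theorem IsIOCPlus.exists_above {h : ℝ → ℝ → ℝ} {F : ℝ} {p : ℤ} {q : ℕ} (hq : 0 < q)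
    {ℓ : Set State} (hℓ : IsIOCPlus h F p q ℓ) {x : State} (hx : x ∈ ℓ) (hlt : T q p x < x)
    {r : ℝ} (hr : 0 < r) :
    ∃ z ∈ ℓ, x < z ∧ (∀ n, |z n - x n| ≤ r) ∧ Summable fun n => ‖z n - x n‖ ^ 2 := by
  have hsum := hℓ.summable_shift_sub hq hx
  have hxy : x < T (-q) (-p) x := by
    refine lt_of_le_of_ne (fun n => ?_) fun he => hlt.ne ?_
    · have := hlt.le (n + q)
      simp only [T, add_sub_cancel_right, sub_neg_eq_add] at this ⊢
      push_cast
      linarith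
    · funext n
      have := congrFun he (n - q)
      simp only [T, sub_neg_eq_add, sub_add_cancel] at this ⊢
      push_cast at this
      linarith
  obtain ⟨⟨⟨⟨τ, hX, hc, hm, -, rfl⟩, hT⟩, -⟩, -⟩ := hℓ
  obtain ⟨s, rfl⟩ := hx
  have hmono : StrictMono τ := fun a b => hm a b
  have hy : T (-q) (-p) (τ s) ∈ Set.range τ := by
    rw [← hT (-q) (-p)]
    exact Set.mem_image_of_mem _ ⟨s, rfl⟩
  obtain ⟨t, ht⟩ := hy
  rw [← ht] at hxy hsum
  have hfin : {n | ¬ |τ t n - τ s n| ≤ r}.Finite := by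
    have := hsum.tendsto_cofinite_zero.eventually (Metric.ball_mem_nhds _ hr)
    refine Set.Finite.subset this fun n hn hn' => hn ?_
    have hn'' : dist (τ t n - τ s n) 0 < r := hn'
    rw [Real.dist_eq, sub_zero] at hn''
    exact hn''.le
  have ev := (eventually_close_on_finset hX (hc s) hfin.toFinset hr).filter_mono
    (nhdsWithin_le_nhds (s := Set.Ioi s))
  obtain ⟨a, ha, ⟨hsa, hat⟩⟩ := (ev.and (Ioo_mem_nhdsGT (hmono.lt_iff_lt.1 hxy))).exists
  have hl : ∀ n, τ s n ≤ τ a n := (hmono hsa).le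
  have hu : ∀ n, τ a n ≤ τ t n := (hmono hat).le
  refine ⟨τ a, ⟨a, rfl⟩, hmono hsa, fun n => ?_, ?_⟩
  · by_cases hn : |τ t n - τ s n| ≤ r
    · refine le_trans ?_ hn
      rw [abs_of_nonneg (by linarith [hl n]), abs_of_nonneg (by linarith [hl n, hu n])]
      linarith [hu n]
    · exact ha n (by simpa using hn)
  · have h0 : ∀ n, 0 ≤ τ t n - τ s n := fun n => by linarith [hl n, hu n]
    refine Summable.of_nonneg_of_le (fun n => by positivity) (fun n => ?_)
      -- Each difference is at most the total sum, so its square is at most the total sum times the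
      -- term.
      (hsum.mul_left (∑' n, (τ t n - τ s n)))
    rw [Real.norm_eq_abs, sq_abs, sq]
    exact mul_le_mul ((by linarith [hu n] : _ ≤ τ t n - τ s n).trans
      (hsum.le_tsum n fun j _ => h0 j)) (by linarith [hu n]) (by linarith [hl n])
      (tsum_nonneg h0)

/-- Closeness on a finite set is enough here, since these states are tested only against finitely
supported sequences. -/
theorem IsOrderedCircle.exists_below {ℓ : Set State} (hℓ : IsOrderedCircle ℓ) {x : State}
    (hx : x ∈ ℓ) (S : Finset ℤ) {r : ℝ} (hr : 0 < r) :
    ∃ z ∈ ℓ, z < x ∧ ∀ n ∈ S, |z n - x n| ≤ r := by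
  obtain ⟨τ, hX, hc, hm, -, rfl⟩ := hℓ
  obtain ⟨s, rfl⟩ := hx
  have ev := (eventually_close_on_finset hX (hc s) S hr).filter_mono
    (nhdsWithin_le_nhds (s := Set.Iio s))
  obtain ⟨a, ha, has⟩ := (ev.and self_mem_nhdsWithin).exists
  exact ⟨τ a, ⟨a, rfl⟩, hm a s has, ha⟩

/-! ### Jacobi operators on `ℓ²` -/

theorem summable_sq (v : Ell2) : Summable fun i => v i ^ 2 := by
  have := lp.summable_inner (𝕜 := ℝ) v v
  simpa [sq] using this

theorem norm_sq_eq_tsum (v : Ell2) : ‖v‖ ^ 2 = ∑' i, v i ^ 2 := by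
  rw [← real_inner_self_eq_norm_sq, lp.inner_eq_tsum]
  simp [sq]

/-- A shift followed by multiplication with a bounded sequence is a bounded operator. -/
theorem exists_shiftMul {a : ℤ → ℝ} {C : ℝ} (ha : ∀ i, |a i| ≤ C) (k : ℤ) :
    ∃ M : Ell2 →L[ℝ] Ell2, ∀ (η : Ell2) (i : ℤ), M η i = a i * η (i + k) := by
  have hC : 0 ≤ C := (abs_nonneg _).trans (ha 0)
  have hs : ∀ η : Ell2, Summable fun i => η (i + k) ^ 2 := fun η =>
    (summable_sq η).comp_injective (Equiv.addRight k).injective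
  have hle : ∀ (η : Ell2) (i : ℤ), (a i * η (i + k)) ^ 2 ≤ C ^ 2 * η (i + k) ^ 2 :=
    fun η i => by
      rw [mul_pow]
      exact mul_le_mul_of_nonneg_right (sq_le_sq' (abs_le.1 (ha i)).1 (abs_le.1 (ha i)).2)
        (sq_nonneg _)
  have hs' : ∀ η : Ell2, Summable fun i => (a i * η (i + k)) ^ 2 := fun η =>
    Summable.of_nonneg_of_le (fun i => sq_nonneg _) (hle η) ((hs η).mul_left _)
  have hmem : ∀ η : Ell2, Memℓp (fun i => a i * η (i + k)) 2 := fun η =>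
    memℓp_gen (by simpa [← mul_pow, ← abs_mul] using hs' η)
  let L : Ell2 →ₗ[ℝ] Ell2 :=
    { toFun := fun η => ⟨fun i => a i * η (i + k), hmem η⟩
      map_add' := fun η ζ => by
        ext i
        exact mul_add _ _ _
      map_smul' := fun t η => by
        ext i
        exact mul_left_comm _ _ _ }
  refine ⟨L.mkContinuous C fun η => ?_, fun η i => rfl⟩
  refine (sq_le_sq₀ (norm_nonneg _) (by positivity)).1 ?_
  rw [norm_sq_eq_tsum, mul_pow, norm_sq_eq_tsum, ← tsum_mul_left]
  calc _ ≤ ∑' i, C ^ 2 * η (i + k) ^ 2 := (hs' η).tsum_le_tsum (hle η) ((hs η).mul_left _)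
    _ = _ := (Equiv.addRight k).tsum_eq fun i => C ^ 2 * η i ^ 2

/-- Bounded coefficients define a bounded symmetric Jacobi operator. -/
theorem exists_jacobi {α β : ℤ → ℝ} {C : ℝ} (hα : ∀ i, |α i| ≤ C) (hβ : ∀ i, |β i| ≤ C) :
    ∃ A : Ell2 →L[ℝ] Ell2,
      (∀ (η : Ell2) (i : ℤ), A η i = α i * η (i - 1) + β i * η i + α (i + 1) * η (i + 1)) ∧
        ∀ u v : Ell2, ⟪A u, v⟫ = ⟪u, A v⟫ := by
  obtain ⟨L, hL⟩ := exists_shiftMul hα (-1)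
  obtain ⟨D, hD⟩ := exists_shiftMul hβ 0
  obtain ⟨R, hR⟩ := exists_shiftMul (fun i => hα (i + 1)) 1
  have hDs : ∀ u v : Ell2, ⟪D u, v⟫ = ⟪u, D v⟫ := fun u v => by
    rw [lp.inner_eq_tsum, lp.inner_eq_tsum]
    refine tsum_congr fun i => ?_
    simp only [hD, Real.inner_apply, add_zero]
    ring
  have hLR : ∀ u v : Ell2, ⟪L u, v⟫ = ⟪u, R v⟫ := fun u v => by
    rw [lp.inner_eq_tsum, lp.inner_eq_tsum, ← (Equiv.addRight (1 : ℤ)).tsum_eq]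
    refine tsum_congr fun i => ?_
    simp only [hL, hR, Real.inner_apply, Equiv.coe_addRight, add_neg_cancel_right]
    ring
  have hRL : ∀ u v : Ell2, ⟪R u, v⟫ = ⟪u, L v⟫ := fun u v => by
    rw [real_inner_comm, ← hLR, real_inner_comm]
  refine ⟨L + D + R, fun η i => ?_, fun u v => ?_⟩
  · simp [hL, hD, hR, sub_eq_add_neg]
  · simp only [add_apply, inner_add_left, inner_add_right, hDs, hLR, hRL]
    ring

/-- A symmetric invertible operator with nonpositive quadratic form is coercive. -/
theorem exists_coercive_of_nonpos {H : Type*} [NormedAddCommGroup H] [InnerProductSpace ℝ H]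
    {A : H →L[ℝ] H} (hs : ∀ u v, ⟪A u, v⟫ = ⟪u, A v⟫) (hA : ∀ v, ⟪v, A v⟫ ≤ 0)
    (h0 : (0 : ℝ) ∉ spectrum ℝ A) : ∃ κ > 0, ∀ v, ⟪v, A v⟫ ≤ -κ * ‖v‖ ^ 2 := by
  obtain ⟨U, rfl⟩ := spectrum.zero_notMem_iff ℝ |>.1 h0
  set A : H →L[ℝ] H := (U : H →L[ℝ] H)
  set B : H →L[ℝ] H := ((U⁻¹ : (H →L[ℝ] H)ˣ) : H →L[ℝ] H)
  have hBA : ∀ v, B (A v) = v := fun v => by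
    rw [← mul_apply_eq_comp, Units.inv_mul]; rfl
  -- Adding one keeps both constants positive even when the norms vanish.
  set M := ‖A‖ + 1
  set b := ‖B‖ + 1
  have hM : 0 < M := by positivity
  have hb : 0 < b := by positivity
  refine ⟨(M * b ^ 2)⁻¹, by positivity, fun v => ?_⟩
  have h1 : ‖v‖ ≤ b * ‖A v‖ := by
    calc ‖v‖ = ‖B (A v)‖ := by rw [hBA]
      _ ≤ ‖B‖ * ‖A v‖ := B.le_opNorm _
      _ ≤ b * ‖A v‖ := by gcongr; linarith
  have h2 : ‖A v‖ ^ 2 ≤ M * -⟪v, A v⟫ := by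
    -- Cauchy–Schwarz for the semidefinite form of `-A`, obtained by testing it on one well-chosen
    -- vector.
    have e := hA (M • v + A v)
    rw [map_add, map_smul, inner_add_left, inner_add_right, inner_add_right, inner_smul_left,
      inner_smul_right, inner_smul_left, inner_smul_right, ← hs v (A v),
      real_inner_self_eq_norm_sq] at e
    have e' : -(M * ‖A v‖ ^ 2) ≤ ⟪A v, A (A v)⟫ := by
      have k1 := abs_le.1 (abs_real_inner_le_norm (A v) (A (A v)))
      have k2 := A.le_opNorm (A v)
      have k3 : ‖A v‖ * ‖A (A v)‖ ≤ ‖A v‖ * (‖A‖ * ‖A v‖) := by gcongr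
      nlinarith [sq_nonneg ‖A v‖, k1.1]
    simp only [conj_trivial] at e
    have : M * (‖A v‖ ^ 2 - M * -⟪v, A v⟫) ≤ 0 := by nlinarith
    exact sub_nonpos.1 (nonpos_of_mul_nonpos_right this hM)
  have h3 : ‖v‖ ^ 2 ≤ M * b ^ 2 * -⟪v, A v⟫ := by
    calc ‖v‖ ^ 2 ≤ (b * ‖A v‖) ^ 2 := by gcongr
      _ = b ^ 2 * ‖A v‖ ^ 2 := mul_pow _ _ _
      _ ≤ b ^ 2 * (M * -⟪v, A v⟫) := by gcongr
      _ = _ := by ring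
  have := (inv_mul_le_iff₀ (by positivity)).2 h3
  linarith

/-- Positive approximate supersolutions make the Jacobi form nonpositive on finitely supported
sequences. -/
theorem jacobi_form_nonpos_of_supersolution {α β : ℤ → ℝ} {c : ℝ} (hc : 0 < c)
    (hα : ∀ i, c ≤ α i) (S : Finset ℤ)
    (hu : ∀ δ > 0, ∃ u : ℤ → ℝ, (∀ i, 0 < u i) ∧ ∀ i ∈ S, ∃ a b a' : ℝ,
      |a - α i| ≤ δ ∧ |b - β i| ≤ δ ∧ |a' - α (i + 1)| ≤ δ ∧
        a * u (i - 1) + b * u i + a' * u (i + 1) ≤ 0)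
    {v : ℤ → ℝ} (hv : ∀ i ∉ S, v i = 0) :
    ∑' i, v i * (α i * v (i - 1) + β i * v i + α (i + 1) * v (i + 1)) ≤ 0 := by
  have fin : ∀ {f : ℤ → ℝ}, (∀ i, v i = 0 → f i = 0) → Summable f := fun hf =>
    summable_of_ne_finset_zero (s := S) fun i hi => hf i (hv i hi)
  have hL : Summable fun i => v i * (α i * v (i - 1) + β i * v i + α (i + 1) * v (i + 1)) :=
    fin fun i hi => by rw [hi, zero_mul]
  have hV : Summable fun i => v i ^ 2 := fin fun i hi => by simp [hi]
  have hVm : Summable fun i => v (i - 1) ^ 2 :=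
    hV.comp_injective (Equiv.subRight (1 : ℤ)).injective
  have hVp : Summable fun i => v (i + 1) ^ 2 :=
    hV.comp_injective (Equiv.addRight (1 : ℤ)).injective
  have tVm : ∑' i, v (i - 1) ^ 2 = ∑' i, v i ^ 2 :=
    (Equiv.subRight (1 : ℤ)).tsum_eq fun i => v i ^ 2
  have tVp : ∑' i, v (i + 1) ^ 2 = ∑' i, v i ^ 2 :=
    (Equiv.addRight (1 : ℤ)).tsum_eq fun i => v i ^ 2
  have hV0 : 0 ≤ ∑' i, v i ^ 2 := tsum_nonneg fun i => sq_nonneg _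
  have main : ∀ δ, 0 < δ → δ < c →
      ∑' i, v i * (α i * v (i - 1) + β i * v i + α (i + 1) * v (i + 1)) ≤
        3 * δ * ∑' i, v i ^ 2 := by
    intro δ hδ hδc
    obtain ⟨u, hu0, hu⟩ := hu δ hδ
    -- `P` and `N` collect the bonds to the left and right neighbour, with the diagonal replaced by
    -- its bound from the row inequality divided by `u i`. Lowering the weights to `α - δ` makes
    -- them independent of the perturbed coefficients.
    set P : ℤ → ℝ := fun i => (α i - δ) * (v (i - 1) * v i - u (i - 1) / u i * v i ^ 2) with hP
    set N : ℤ → ℝ := fun i =>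
      (α (i + 1) - δ) * (v i * v (i + 1) - u (i + 1) / u i * v i ^ 2) with hN
    have sP : Summable P := fin fun i hi => by simp [hP, hi]
    have sN : Summable N := fin fun i hi => by simp [hN, hi]
    have sP' : Summable fun i => P (i + 1) :=
      sP.comp_injective (Equiv.addRight (1 : ℤ)).injective
    -- Picone-type identity: regrouped by bonds instead of sites, the two contributions of a bond
    -- form minus a positive weight times a square.
    have tPN : ∑' i, P i + ∑' i, N i ≤ 0 := by
      rw [← (Equiv.addRight (1 : ℤ)).tsum_eq P]
      simp only [Equiv.coe_addRight]
      rw [← sP'.tsum_add sN]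
      refine tsum_nonpos fun i => ?_
      have h1 := hu0 i
      have h2 := hu0 (i + 1)
      have : P (i + 1) + N i = -((α (i + 1) - δ) *
          ((u i * v (i + 1) - u (i + 1) * v i) ^ 2 / (u i * u (i + 1)))) := by
        simp only [hP, hN, add_sub_cancel_right]
        field_simp
        ring
      rw [this, neg_nonpos]
      exact mul_nonneg (by linarith [hα (i + 1)]) (by positivity)
    have pt : ∀ i, v i * (α i * v (i - 1) + β i * v i + α (i + 1) * v (i + 1)) ≤
        δ * (2 * v i ^ 2 + v (i - 1) ^ 2 / 2 + v (i + 1) ^ 2 / 2) + (P i + N i) := by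
      intro i
      by_cases hi : i ∈ S
      · obtain ⟨a, b, a', ha, hb, ha', hrow⟩ := hu i hi
        have h0 := hu0 i
        have r1 : 0 < u (i - 1) / u i := div_pos (hu0 _) h0
        have r2 : 0 < u (i + 1) / u i := div_pos (hu0 _) h0
        have hrow' : b ≤ -(a * (u (i - 1) / u i)) - a' * (u (i + 1) / u i) := by
          have := div_nonpos_of_nonpos_of_nonneg hrow h0.le
          rw [add_div, add_div, mul_div_cancel_right₀ _ h0.ne', mul_div_assoc,
            mul_div_assoc] at this
          linarith
        have k1 := mul_le_mul_of_nonneg_right (by linarith [(abs_le.1 ha).1] : α i - δ ≤ a) r1.le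
        have k2 := mul_le_mul_of_nonneg_right
          (by linarith [(abs_le.1 ha').1] : α (i + 1) - δ ≤ a') r2.le
        have k3 : β i ≤ δ - (α i - δ) * (u (i - 1) / u i) -
            (α (i + 1) - δ) * (u (i + 1) / u i) := by linarith [(abs_le.1 hb).1]
        have k4 := mul_le_mul_of_nonneg_right k3 (sq_nonneg (v i))
        have k5 := mul_nonneg hδ.le (sq_nonneg (v i - v (i - 1)))
        have k6 := mul_nonneg hδ.le (sq_nonneg (v i - v (i + 1)))
        simp only [hP, hN]
        nlinarith
      · simp only [hP, hN, hv i hi]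
        simp only [zero_mul, mul_zero, ne_eq, OfNat.ofNat_ne_zero, not_false_eq_true, zero_pow,
          sub_zero, add_zero, zero_add]
        positivity
    have sR : Summable fun i => δ * (2 * v i ^ 2 + v (i - 1) ^ 2 / 2 + v (i + 1) ^ 2 / 2) :=
      (((hV.mul_left 2).add (hVm.div_const 2)).add (hVp.div_const 2)).mul_left δ
    have := hL.tsum_le_tsum pt (sR.add (sP.add sN))
    rw [sR.tsum_add (sP.add sN), sP.tsum_add sN, tsum_mul_left,
      ((hV.mul_left 2).add (hVm.div_const 2)).tsum_add (hVp.div_const 2),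
      (hV.mul_left 2).tsum_add (hVm.div_const 2), tsum_mul_left, tsum_div_const,
      tsum_div_const, tVm, tVp] at this
    linarith
  refine le_of_forall_pos_lt_add fun ε hε => ?_
  set V := ∑' i, v i ^ 2
  -- The bound `c / 2` keeps `δ < c`; the other makes the error at most `ε / 2`, with `V + 1`
  -- avoiding division by zero.
  have := main (min (c / 2) (ε / (6 * (V + 1)))) (by positivity)
    ((min_le_left _ _).trans_lt (half_lt_self hc))
  have h2 : min (c / 2) (ε / (6 * (V + 1))) * V ≤ ε / (6 * (V + 1)) * (V + 1) := by
    refine mul_le_mul (min_le_right _ _) (by linarith) hV0 (by positivity)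
  have h3 : ε / (6 * (V + 1)) * (V + 1) = ε / 6 := by field_simp
  linarith

/-- A bounded quadratic form on `ℓ²` that is nonpositive on finitely supported sequences is
nonpositive. -/
theorem inner_nonpos_of_finite_support {A : Ell2 →L[ℝ] Ell2}
    (h : ∀ (S : Finset ℤ) (v : Ell2), (∀ i ∉ S, v i = 0) → ⟪v, A v⟫ ≤ 0) (v : Ell2) :
    ⟪v, A v⟫ ≤ 0 := by
  have hs := lp.hasSum_single (p := 2) (by simp) v
  have hlim : Tendsto (fun S : Finset ℤ => ⟪∑ i ∈ S, lp.single 2 i (v i),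
      A (∑ i ∈ S, lp.single 2 i (v i))⟫) atTop (𝓝 ⟪v, A v⟫) :=
    Tendsto.inner hs ((A.continuous.tendsto v).comp hs)
  refine le_of_tendsto' hlim fun S => h S _ fun i hi => ?_
  rw [lp.coeFn_sum, Finset.sum_apply]
  refine Finset.sum_eq_zero fun j hj => lp.single_apply_ne 2 j _ ?_
  rintro rfl
  exact hi hj

/-- A nonnegative approximate subsolution in `ℓ²` bounds the Jacobi form from below. -/
theorem le_inner_of_subsolution {α β : ℤ → ℝ} {A : Ell2 →L[ℝ] Ell2}
    (hA : ∀ (η : Ell2) (i : ℤ),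
      A η i = α i * η (i - 1) + β i * η i + α (i + 1) * η (i + 1))
    {w : Ell2} (hw : ∀ i, 0 ≤ w i) {δ : ℝ} (hδ : 0 ≤ δ)
    (hrow : ∀ i, ∃ a b a' : ℝ,
      |a - α i| ≤ δ ∧ |b - β i| ≤ δ ∧ |a' - α (i + 1)| ≤ δ ∧
        0 ≤ a * w (i - 1) + b * w i + a' * w (i + 1)) :
    -(3 * δ * ‖w‖ ^ 2) ≤ ⟪w, A w⟫ := by
  have hV := summable_sq w
  have hVm : Summable fun i => w (i - 1) ^ 2 :=
    hV.comp_injective (Equiv.subRight (1 : ℤ)).injective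
  have hVp : Summable fun i => w (i + 1) ^ 2 :=
    hV.comp_injective (Equiv.addRight (1 : ℤ)).injective
  have tVm : ∑' i, w (i - 1) ^ 2 = ∑' i, w i ^ 2 :=
    (Equiv.subRight (1 : ℤ)).tsum_eq fun i => w i ^ 2
  have tVp : ∑' i, w (i + 1) ^ 2 = ∑' i, w i ^ 2 :=
    (Equiv.addRight (1 : ℤ)).tsum_eq fun i => w i ^ 2
  have sR := (((hV.mul_left 2).add (hVm.div_const 2)).add (hVp.div_const 2)).mul_left (-δ)
  -- Because `w ≥ 0`, the coefficient errors cost at most `δ w_i (w_{i-1} + w_i + w_{i+1})`;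
  -- splitting the products into squares gives total weight `2 + 1/2 + 1/2 = 3`.
  have pt : ∀ i, -δ * (2 * w i ^ 2 + w (i - 1) ^ 2 / 2 + w (i + 1) ^ 2 / 2) ≤
      ⟪w i, A w i⟫ := by
    intro i
    obtain ⟨a, b, a', ha, hb, ha', h0⟩ := hrow i
    have k1 := mul_le_mul_of_nonneg_right (abs_le.1 ha).2 (hw (i - 1))
    have k2 := mul_le_mul_of_nonneg_right (abs_le.1 hb).2 (hw i)
    have k3 := mul_le_mul_of_nonneg_right (abs_le.1 ha').2 (hw (i + 1))
    have k4 : -(δ * (w (i - 1) + w i + w (i + 1))) ≤ A w i := by rw [hA]; linarith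
    have k5 := mul_le_mul_of_nonneg_right k4 (hw i)
    have k6 := mul_nonneg hδ (sq_nonneg (w i - w (i - 1)))
    have k7 := mul_nonneg hδ (sq_nonneg (w i - w (i + 1)))
    rw [Real.inner_apply]
    nlinarith
  have := sR.tsum_le_tsum pt (lp.summable_inner w (A w))
  rw [← lp.inner_eq_tsum, tsum_mul_left,
    ((hV.mul_left 2).add (hVm.div_const 2)).tsum_add (hVp.div_const 2),
    (hV.mul_left 2).tsum_add (hVm.div_const 2), tsum_mul_left, tsum_div_const,
    tsum_div_const, tVm, tVp, ← norm_sq_eq_tsum] at this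
  linarith

/-! ### Sign of the second variation and degeneracy -/

/-- The Jacobi coefficients along a state of bounded spacing are bounded. -/
theorem IsEnergy.exists_coeff_bound {h : ℝ → ℝ → ℝ} (hh : IsEnergy h) {x : State} {K : ℝ}
    (hK : ∀ n, |x (n + 1) - x n| ≤ K) :
    ∃ C : ℝ, (∀ i, |offDiag h x i| ≤ C) ∧ ∀ i, |onDiag h x i| ≤ C := by
  obtain ⟨C₁, h₁⟩ := bounded_on_strip hh.continuous_d11 hh.d11_add_one K
  obtain ⟨C₂, h₂⟩ := bounded_on_strip hh.continuous_d12 hh.d12_add_one K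
  obtain ⟨C₃, h₃⟩ := bounded_on_strip hh.continuous_d22 hh.d22_add_one K
  have hK' : ∀ i, |x i - x (i - 1)| ≤ K := fun i => by simpa using hK (i - 1)
  refine ⟨max C₂ (C₃ + C₁), fun i => ?_, fun i => ?_⟩
  · exact (abs_neg (d12 h (x (i - 1)) (x i))).trans_le ((h₂ _ _ (hK' i)).trans (le_max_left _ _))
  · refine le_trans ?_ (le_max_right _ _)
    have := abs_sub (-d22 h (x (i - 1)) (x i)) (d11 h (x i) (x (i + 1)))
    rw [abs_neg] at this
    exact this.trans (add_le_add (h₃ _ _ (hK' i)) (h₁ _ _ (hK i)))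

/-- Strong comparison: a state below an equilibrium with nonnegative field lies strictly below
at every site, unless both coincide. -/
theorem IsEnergy.lt_of_field_nonneg {h : ℝ → ℝ → ℝ} (hh : IsEnergy h) {F K : ℝ} {x z : State}
    (hK : ∀ n, |x (n + 1) - x n| ≤ K) (hx : IsEquilibrium h F x) (hz : ∀ n, 0 ≤ field h F z n)
    (hlt : z < x) (n : ℤ) : z n < x n := by
  obtain ⟨c, hc, htw⟩ := hh.twist
  obtain ⟨_, _, hlin⟩ := hh.field_sub_field F htw hK one_pos
  -- At a contact site the nonnegative field of `z` is a sum of two nonpositive neighbour terms with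
  -- coefficients at least `c > 0`, so both vanish and contact spreads to the neighbours.
  have step : ∀ i, z i = x i → z (i - 1) = x (i - 1) ∧ z (i + 1) = x (i + 1) := by
    intro i hi
    obtain ⟨a, b, a', ha, ha', e, -⟩ := hlin z i
    rw [hx i, hi, sub_self, mul_zero] at e
    have h1 := hlt.le (i - 1)
    have h2 := hlt.le (i + 1)
    have k1 := mul_nonneg (hc.le.trans ha) (sub_nonneg.2 h1)
    have k2 := mul_nonneg (hc.le.trans ha') (sub_nonneg.2 h2)
    have k0 := hz i
    have e1 : a * (x (i - 1) - z (i - 1)) = 0 := by linarith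
    have e2 : a' * (x (i + 1) - z (i + 1)) = 0 := by linarith
    rw [mul_eq_zero, or_iff_right (hc.trans_le ha).ne', sub_eq_zero] at e1
    rw [mul_eq_zero, or_iff_right (hc.trans_le ha').ne', sub_eq_zero] at e2
    exact ⟨e1.symm, e2.symm⟩
  refine lt_of_le_of_ne (hlt.le n) fun hn => hlt.ne (funext fun m => ?_)
  induction m using Int.inductionOn' (b := n) with
  | zero => exact hn
  | succ k _ ih => exact (step k ih).2
  | pred k _ ih => exact (step k ih).1

/-- In an ordered circle on which the field is nonnegative, the second variation at an
equilibrium of bounded spacing is nonpositive. -/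
theorem inner_jacobi_nonpos {h : ℝ → ℝ → ℝ} (hh : IsEnergy h) {F K : ℝ} {ℓ : Set State}
    (hℓ : IsOrderedCircle ℓ) (hmono : ∀ z ∈ ℓ, ∀ n : ℤ, 0 ≤ field h F z n) {x : State}
    (hxℓ : x ∈ ℓ) (hK : ∀ n, |x (n + 1) - x n| ≤ K) (hx : IsEquilibrium h F x)
    {A : Ell2 →L[ℝ] Ell2}
    (hA : ∀ (η : Ell2) (i : ℤ), A η i =
      offDiag h x i * η (i - 1) + onDiag h x i * η i + offDiag h x (i + 1) * η (i + 1))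
    (v : Ell2) : ⟪v, A v⟫ ≤ 0 := by
  obtain ⟨c, hc, htw⟩ := hh.twist
  refine inner_nonpos_of_finite_support (fun S v hv => ?_) v
  have key : ⟪v, A v⟫ = ∑' i, v i * (offDiag h x i * v (i - 1) + onDiag h x i * v i +
      offDiag h x (i + 1) * v (i + 1)) := by
    rw [lp.inner_eq_tsum]
    refine tsum_congr fun i => ?_
    rw [Real.inner_apply, hA]
  rw [key]
  refine jacobi_form_nonpos_of_supersolution hc (fun i => le_neg_of_le_neg (htw _ _)) S
    (fun δ hδ => ?_) hv
  obtain ⟨r, hr, hlin⟩ := hh.field_sub_field F htw hK hδ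
  -- The rows indexed by `S` involve only `S` and its two translates by one site.
  obtain ⟨z, hz, hzx, hclose⟩ := hℓ.exists_below hxℓ
    (S.image (fun i => i - 1) ∪ S ∪ S.image (fun i => i + 1)) hr
  refine ⟨fun i => x i - z i,
    fun i => sub_pos.2 (hh.lt_of_field_nonneg hK hx (hmono z hz) hzx i), fun i hi => ?_⟩
  obtain ⟨a, b, a', -, -, e, hab⟩ := hlin z i
  obtain ⟨h1, h2, h3⟩ := hab
    (hclose _ (Finset.mem_union_left _ (Finset.mem_union_left _ (Finset.mem_image_of_mem _ hi))))
    (hclose _ (Finset.mem_union_left _ (Finset.mem_union_right _ hi)))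
    (hclose _ (Finset.mem_union_right _ (Finset.mem_image_of_mem _ hi)))
  refine ⟨a, b, a', h1, h2, h3, ?_⟩
  rw [hx i] at e
  linarith [hmono z hz i]

/-- An equilibrium of type `p/q+` of an invariant ordered circle of the same type, on which the
field is nonnegative, is degenerate. -/
theorem IsIOCPlus.isDegenerate {h : ℝ → ℝ → ℝ} (hh : IsEnergy h) {p : ℤ} {q : ℕ} (hq : 0 < q)
    {F : ℝ} {ℓ : Set State} (hℓ : IsIOCPlus h F p q ℓ)
    (hmono : ∀ z ∈ ℓ, ∀ n : ℤ, 0 ≤ field h F z n) {x : State} (hxℓ : x ∈ ℓ)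
    (hx : IsEquilibriumPlus h F p q x) : IsDegenerate h x := by
  have hK := fun n => hℓ.abs_spacing_le hxℓ n
  obtain ⟨C, hC₁, hC₂⟩ := hh.exists_coeff_bound hK
  obtain ⟨A, hA, hs⟩ := exists_jacobi hC₁ hC₂
  refine ⟨A, fun η i => ?_, ?_⟩
  · rw [hA]
    simp only [offDiag, onDiag, add_sub_cancel_right]
  by_contra h0
  obtain ⟨κ, hκ, hcoer⟩ := exists_coercive_of_nonpos hs
    (inner_jacobi_nonpos hh hℓ.1.1.1 hmono hxℓ hK hx.1 hA) h0
  obtain ⟨c, hc, htw⟩ := hh.twist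
  -- With `δ = κ / 6` the lower bound is `-(κ / 2) ‖w‖²`, incompatible with coercivity for `w ≠ 0`.
  obtain ⟨r, hr, hlin⟩ := hh.field_sub_field F htw hK (by positivity : 0 < κ / 6)
  obtain ⟨z, hz, hxz, hclose, hsum⟩ := hℓ.exists_above hq hxℓ hx.2.2 hr
  let w : Ell2 := ⟨fun n => z n - x n, memℓp_gen (by simpa using hsum)⟩
  have hw : ∀ n, w n = z n - x n := fun n => rfl
  have hw0 : w ≠ 0 := fun hw0 => hxz.ne (funext fun n => by
    have : w n = 0 := by rw [hw0]; rfl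
    rw [hw, sub_eq_zero] at this
    exact this.symm)
  have hlow := le_inner_of_subsolution hA (w := w) (fun i => sub_nonneg.2 (hxz.le i))
    (by positivity : 0 ≤ κ / 6) fun i => by
      obtain ⟨a, b, a', -, -, e, hab⟩ := hlin z i
      obtain ⟨h1, h2, h3⟩ := hab (hclose _) (hclose _) (hclose _)
      rw [hx.1 i, sub_zero] at e
      exact ⟨a, b, a', h1, h2, h3, (hmono z hz i).trans_eq e⟩
  have hpos : 0 < κ * ‖w‖ ^ 2 := mul_pos hκ (pow_pos (norm_pos_iff.2 hw0) 2)
  linarith [hcoer w]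

end FK

theorem mainTheorem7 (h : ℝ → ℝ → ℝ) (hh : FK.IsEnergy h)
    (p : ℤ) (q : ℕ) (hq : 0 < q) (hpq : IsCoprime p (q : ℤ))
    (F : ℝ)
    (hF₁ : FK.depinningForcePlus h ((p : ℝ) / (q : ℝ)) ≤ F)
    (hF₂ : F < FK.depinningForce h ((p : ℝ) / (q : ℝ)))
    (ℓ : Set FK.State) (hℓ : FK.IsIOCPlus h F p q ℓ)
    (hmono : ∀ z ∈ ℓ, ∀ n : ℤ, 0 ≤ FK.field h F z n) :
    ∀ x ∈ ℓ, FK.IsEquilibriumPlus h F p q x → FK.IsDegenerate h x :=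
  fun _ hx heq => hℓ.isDegenerate hh hq hmono hx heq
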